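/- **Setting.** Let $\mu>0$ and $0<b<1/\sqrt2$. Let $S^1=\mathbb R/2\mathbb Z$ and $M=\mathbb R\times S^1$ with Lebesgue measure, let $T_{a,\theta}(t,x)=(t+a,x+\theta)$, and for $\Re\tau\ge 0$ put $$g(\tau,x)=-\tfrac{\pi\tau}{2}-\tfrac12\log(1-e^{-\pi\tau+\pi i x})-\tfrac12\log(1-e^{-\pi\tau-\pi i x}).$$ Let $k\ge1$, let $n_1,\dots,n_k$ be integers with $|n_j|<\frac1{\sqrt2\,b}$, put $w=-\sum_j n_j$, and let $u_j=(t_j,x_j)\in M$. If $w<0$, put $C_{bn}(u_1,\dots,u_k)=0$. If $w\ge0$, let $\gamma$ be the contour in $\mathbb C$ that runs horizontally from $it_1-\infty$ to $it_1$, then vertically to $it_2,\dots,it_k$ in this order, then horizontally to $it_k+\infty$, and put, with $v_j=(it_j,x_j)$, $$C_{bn}(u_1,\dots,u_k)=\frac{(-\mu)^w}{w!}\,e^{-4b^2\sum_{j<j'}n_jn_{j'}g(\mathcal T(v_j-v_{j'}))}\int_{(\gamma\times S^1)^w}e^{-4b^2\sum_{j,l}n_j\,g(\mathcal T(v_j-y_l))-4b^2\sum_{l<l'}g(\mathcal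 T(y_l-y_{l'}))}\,dy_1\cdots dy_w ,$$ where the integral is a contour integral in the $\gamma$ variables, and $\mathcal T(p-q)$ is the point that comes later along $\gamma$ minus the earlier one ($v_j$ being the $j$-th marked visit of $\gamma$). Let $\mathcal A$ be the unital tensor algebra over $\mathbb C$ of $\bigoplus_{|n|<1/(\sqrt2 b)}C_c^\infty(M,\mathbb C)$, with generators $\mathcal O_{f,n}$. Its involution is conjugate linear and antimultiplicative with $\mathcal O_{f,n}^*=\mathcal O_{\bar f,n}$. Its translations $\eta_{a,\theta}$ ($a\in\mathbb R$, $\theta\in S^1$) are the unital algebra homomorphisms with $\eta_{a,\theta}\mathcal O_{f,n}=\mathcal O_{f\circ T_{-a,-\theta},\,n}$, and $\tau_t=\eta_{-t,0}$. The vacuum functional $\omega$ is the linear functional on $\mathcal A$ with $\omega(1)=1$ and $$\omega(\mathcal O_{f_1,n_1}\cdots\mathcal O_{f_k,n_k})=\int_{M^k}\prod_j f_j(u_j)\,C_{bn}(u_1,\dots,u_k)\,du_1\cdots du_k ,$$ these integrals being absolutely convergent. For open $O\subseteq M$, $\mathcal A(O)$ is the unital $*$-subalgebra generated by the $\mathcal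 O_{f,n}$ with $\operatorname{supp} f\subseteq O$. Let $\Phi(A)=(\omega(B^*A))_{B\in\mathcal A}\in\mathbb C^{\mathcal A}$ (product topology), $\mathcal H_0=\Phi(\mathcal A)$, $\mathcal H=\overline{\mathcal H_0}$, $\Omega=\Phi(1)$. On $\mathcal H_0\times\mathcal H$ let $(\Phi(A),z)=z_A$, and on $\mathcal H$ let $\pi(C)z=(z_{C^*A})_A$, which is a continuous linear map $\mathcal H\to\mathcal H$. Let $\mathrm{End}_\dagger(\mathcal H)$ be the set of continuous linear $T:\mathcal H\to\mathcal H$ for which there is a continuous linear $S:\mathcal H\to\mathcal H$ such that $T$ and $S$ preserve $\mathcal H_0$ and $(Tu,z)=(u,Sz)$, $(Su,z)=(u,Tz)$ for all $u\in\mathcal H_0$, $z\in\mathcal H$; write $T^\dagger=S$. Give it the topology in which $T_\nu\to T$ iff $T_\nu\to T$ and $T_\nu^\dagger\to T^\dagger$ uniformly on bounded subsets of $\mathcal H$. Let $\mathfrak A_{\rm loc}(O)$ be the closure of $\pi(\mathcal A(O))$ in $\mathrm{End}_\dagger(\mathcal H)$. **Theorem (Translation covariance).** The pairing is well defined, and $\pi(C)\in\mathrm{End}_\dagger(\mathcal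 H)$ with $\pi(C)^\dagger=\pi(C^*)$ for every $C\in\mathcal A$. For $(a,\theta)\in\mathbb R\times S^1$ the formula $$U_{\rm cyl}(a,\theta)z=(z_{\eta_{-a,-\theta}A})_{A\in\mathcal A}$$ defines a linear homeomorphism of $\mathcal H$ onto itself, and these maps form an algebraic action of the group $\mathbb R\times S^1$ on $\mathcal H$: $U_{\rm cyl}(0,0)=\mathrm{id}$ and $U_{\rm cyl}(a+a',\theta+\theta')=U_{\rm cyl}(a,\theta)U_{\rm cyl}(a',\theta')$. Moreover, for all $(a,\theta)$: 1. $U_{\rm cyl}(a,\theta)\Phi(A)=\Phi(\eta_{a,\theta}A)$ for all $A\in\mathcal A$; in particular $\mathcal H_0$ is invariant. 2. $(U_{\rm cyl}(a,\theta)u,z)=(u,U_{\rm cyl}(-a,-\theta)z)$ for $u\in\mathcal H_0$, $z\in\mathcal H$; and $(U_{\rm cyl}(a,\theta)u,U_{\rm cyl}(a,\theta)v)=(u,v)$ for $u,v\in\mathcal H_0$. 3. $U_{\rm cyl}(a,\theta)\Omega=\Omega$, and $U_{\rm cyl}(a,\theta)\pi(C)U_{\rm cyl}(a,\theta)^{-1}=\pi(\eta_{a,\theta}C)$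 for all $C\in\mathcal A$. 4. For open $O_1\subseteq O_2$ in $M$, $\mathfrak A_{\rm loc}(O_1)\subseteq\mathfrak A_{\rm loc}(O_2)$; and for every open $O\subseteq M$, $U_{\rm cyl}(a,\theta)\,\mathfrak A_{\rm loc}(O)\,U_{\rm cyl}(a,\theta)^{-1}=\mathfrak A_{\rm loc}(T_{a,\theta}O)$. 5. With $U(t)=U_{\rm cyl}(t,0)$: $U(t)\Phi(A)=\Phi(\tau_{-t}A)$ for all $A\in\mathcal A$ and $t\in\mathbb R$, and $(U(t))_{t\in\mathbb R}$ is an algebraic one-parameter group of linear homeomorphisms of $\mathcal H$. -/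

import Mathlib

open scoped ContDiff TensorProduct DirectSum Nat

namespace TimelikeLiouville

noncomputable section

/-! ## The cylinder, the Green's function and the Lorentzian correlators -/

instance factTwoPos : Fact ((0 : ℝ) < 2) := ⟨two_pos⟩

/-- The spatial circle: `[-1, 1]` with its end points identified, of total length `2`. -/
abbrev Circ : Type := AddCircle (2 : ℝ)

/-- The infinite cylinder `M = ℝ × S¹`, with Lebesgue measure. -/
abbrev Cyl : Type := ℝ × Circ

/-- The continued Green's function (used for `Re τ ≥ 0`),
`g(τ, x) = -πτ/2 - ½ log(1 - e^{-πτ + πix}) - ½ log(1 - e^{-πτ - πix})`, with the principal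
logarithm; `AddCircle.toCircle x` is `e^{πix}` on the circle of length `2`. -/
def green (τ : ℂ) (x : Circ) : ℂ :=
  -(Real.pi * τ / 2)
    - (1 / 2) * Complex.log (1 - Complex.exp (-(Real.pi * τ)) * (AddCircle.toCircle x : ℂ))
    - (1 / 2) * Complex.log (1 - Complex.exp (-(Real.pi * τ)) * (AddCircle.toCircle (-x) : ℂ))

/-- The parametrized contour through `i t₀, …, i t_m`: it comes in horizontally from
`i t₀ - ∞` for `s ≤ 0`, runs from `i t_j` to `i t_{j+1}` for `s ∈ [j, j+1]`, and leaves
horizontally to `i t_m + ∞` for `s ≥ m`. In particular it visits `i t_j` at `s = j`. -/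
def contour {m : ℕ} (t : Fin (m + 1) → ℝ) (s : ℝ) : ℂ :=
  ((min s 0 + max (s - m) 0 : ℝ) : ℂ) + Complex.I *
    ((t 0 + ∑ j : Fin m, (t j.succ - t j.castSucc) * max 0 (min 1 (s - (j : ℕ))) : ℝ) : ℂ)

/-- `g` of the time-ordered difference of two points `p`, `p'` carrying contour parameters
`s`, `s'`: the point with the larger parameter minus the one with the smaller. -/
def orderedGreen (s : ℝ) (p : ℂ × Circ) (s' : ℝ) (p' : ℂ × Circ) : ℂ :=
  if s < s' then green (p'.1 - p.1) (p'.2 - p.2) else green (p.1 - p'.1) (p.2 - p'.2)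

/-- The ordered Lorentzian correlator of vertex operators with charges `α j` at the points
`u j`, with `w` screening insertions, as a `w`-fold integral over the tube
`contour × circle`. The `j`-th insertion carries the contour parameter `j`. -/
def correlator (μ b : ℝ) {m : ℕ} (α : Fin (m + 1) → ℂ) (w : ℕ) (u : Fin (m + 1) → Cyl) : ℂ :=
  let γ : ℝ → ℂ := contour fun j => (u j).1
  let v : Fin (m + 1) → ℂ × Circ := fun j => (Complex.I * ((u j).1 : ℂ), (u j).2)
  (-(μ : ℂ)) ^ w / (w ! : ℂ)
    * Complex.exp (-4 * ∑ j, ∑ j' ∈ Finset.Ioi j,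
        α j * α j' * orderedGreen ((j : ℕ) : ℝ) (v j) ((j' : ℕ) : ℝ) (v j'))
    * ∫ y : Fin w → Circ, ∫ s : Fin w → ℝ,
        Complex.exp (
            -4 * b * ∑ j, ∑ l, α j * orderedGreen ((j : ℕ) : ℝ) (v j) (s l) (γ (s l), y l)
            - 4 * b ^ 2 * ∑ l, ∑ l' ∈ Finset.Ioi l,
                orderedGreen (s l) (γ (s l), y l) (s l') (γ (s l'), y l'))
          * ∏ l, deriv γ (s l)

/-- The correlator with integer charges `b n_j`: the screening number is `w = -∑ n_j`, and the
correlator vanishes identically if `w < 0`. -/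
def chargeCorrelator (μ b : ℝ) {m : ℕ} (n : Fin (m + 1) → ℤ) (u : Fin (m + 1) → Cyl) : ℂ :=
  if 0 ≤ -∑ j, n j then
    correlator μ b (fun j => (b : ℂ) * (n j : ℂ)) (-∑ j, n j).toNat u
  else 0

/-! ## Test functions and the global algebra -/

/-- `C_c^∞(M, ℂ)`; smoothness on the cylinder is smoothness of the lift to `ℝ × ℝ`. -/
def TestFn : Submodule ℂ (Cyl → ℂ) where
  carrier := {f | ContDiff ℝ ∞ (fun p : ℝ × ℝ => f (p.1, (p.2 : Circ))) ∧ HasCompactSupport f}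
  add_mem' hf hg := ⟨hf.1.add hg.1, hf.2.add hg.2⟩
  zero_mem' := ⟨contDiff_const, HasCompactSupport.zero⟩
  smul_mem' c _ hf := ⟨hf.1.const_smul c, hf.2.smul_left (f := fun _ => c)⟩

/-- The complex conjugate of a test function. -/
def testConj (f : TestFn) : TestFn :=
  ⟨fun u => starRingEnd ℂ (f.1 u),
    Complex.conjCLE.contDiff.comp f.2.1, f.2.2.comp_left (map_zero (starRingEnd ℂ))⟩

/-- The translation `T_{a,θ}` of the cylinder. -/
def cylTranslate (a : ℝ) (θ : Circ) (u : Cyl) : Cyl := (u.1 + a, u.2 + θ)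

/-- Translation of test functions, `(η_{a,θ} f)(u) = f(T_{-a,-θ} u)`. -/
def testTranslate (a : ℝ) (θ : Circ) : TestFn →ₗ[ℂ] TestFn where
  toFun f := ⟨fun u => f.1 (cylTranslate (-a) (-θ) u), by
    constructor
    · obtain ⟨θ', rfl⟩ := QuotientAddGroup.mk_surjective θ
      exact f.2.1.comp (g := fun p : ℝ × ℝ => f.1 (p.1, (p.2 : Circ)))
        (f := fun p : ℝ × ℝ => (p.1 + -a, p.2 + -θ')) (by fun_prop)
    · exact f.2.2.comp_homeomorph
        ((Homeomorph.addRight (-a)).prodCongr (Homeomorph.addRight (-θ)))⟩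
  map_add' _ _ := rfl
  map_smul' _ _ := rfl

/-- The admissible integer charges `|n| < 1 / (√2 b)`. -/
abbrev Charge (b : ℝ) : Type := {n : ℤ // |(n : ℝ)| < 1 / (Real.sqrt 2 * b)}

instance chargeFinite (b : ℝ) : Finite (Charge b) := by
  refine Set.Finite.subset (Set.finite_Icc (-⌈1 / (Real.sqrt 2 * b)⌉) ⌈1 / (Real.sqrt 2 * b)⌉) ?_
  intro n hn
  have h1 : |(n : ℝ)| < (⌈1 / (Real.sqrt 2 * b)⌉ : ℤ) := lt_of_lt_of_le hn (Int.le_ceil _)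
  rw [abs_lt] at h1
  exact ⟨by exact_mod_cast h1.1.le, by exact_mod_cast h1.2.le⟩

instance chargeFintype (b : ℝ) : Fintype (Charge b) := Fintype.ofFinite _

/-- The space of generators: the direct sum of copies of `C_c^∞(M)` over the charges. -/
abbrev Gen (b : ℝ) : Type := ⨁ _ : Charge b, TestFn

/-- The global ordered algebra: the unital tensor algebra over the generators. -/
abbrev Obs (b : ℝ) : Type := TensorAlgebra ℂ (Gen b)

/-- The basic smeared observable with test function `f` and charge `b n`. -/
def smeared {b : ℝ} (f : TestFn) (n : Charge b) : Obs b :=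
  TensorAlgebra.ι ℂ (DirectSum.lof ℂ (Charge b) (fun _ => TestFn) n f)

/-! ### The involution

It is obtained from the universal property of the tensor algebra, as an algebra homomorphism
into the opposite algebra with conjugated scalars. -/

/-- The opposite of a complex algebra, with conjugated scalar multiplication. -/
def ConjOp (A : Type*) : Type _ := Aᵐᵒᵖ

instance conjOpRing (A : Type*) [Ring A] : Ring (ConjOp A) := inferInstanceAs (Ring Aᵐᵒᵖ)

instance conjOpAlgebra (A : Type*) [Ring A] [Algebra ℂ A] : Algebra ℂ (ConjOp A) :=
  Algebra.compHom Aᵐᵒᵖ (starRingEnd ℂ)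

/-- On generators, `O_{f,n} ↦ O_{f̄,n}`, as a linear map into `ConjOp`. -/
def starGen (b : ℝ) : Gen b →ₗ[ℂ] ConjOp (Obs b) :=
  DirectSum.toModule ℂ (Charge b) (ConjOp (Obs b)) fun n =>
    { toFun := fun f => (MulOpposite.op (smeared (testConj f) n) : (Obs b)ᵐᵒᵖ)
      map_add' := fun f g => by
        have h : testConj (f + g) = testConj f + testConj g :=
          Subtype.ext (funext fun u => map_add (starRingEnd ℂ) (f.1 u) (g.1 u))
        have h2 : smeared (testConj (f + g)) n = smeared (testConj f) n + smeared (testConj g) n := by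
          rw [h]; simp [smeared]
        exact congrArg MulOpposite.op h2
      map_smul' := fun c f => by
        have h : testConj (c • f) = starRingEnd ℂ c • testConj f :=
          Subtype.ext (funext fun u => map_mul (starRingEnd ℂ) c (f.1 u))
        have h2 : smeared (testConj (c • f)) n = starRingEnd ℂ c • smeared (testConj f) n := by
          rw [h]; simp [smeared]
        exact congrArg MulOpposite.op h2 }

/-- The involution as an algebra homomorphism into `ConjOp`. -/
def starHom (b : ℝ) : Obs b →ₐ[ℂ] ConjOp (Obs b) := TensorAlgebra.lift ℂ (starGen b)

/-- The involution: conjugate linear, antimultiplicative, and `O_{f,n}^* = O_{f̄,n}`. -/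
instance obsStar (b : ℝ) : Star (Obs b) := ⟨fun A => MulOpposite.unop (starHom b A : (Obs b)ᵐᵒᵖ)⟩

theorem star_smeared {b : ℝ} (f : TestFn) (n : Charge b) :
    star (smeared f n) = smeared (testConj f) n := by
  change MulOpposite.unop (starHom b (smeared f n) : (Obs b)ᵐᵒᵖ) = _
  simp only [starHom, smeared, TensorAlgebra.lift_ι_apply, starGen, DirectSum.toModule_lof]
  rfl

theorem obs_star_add {b : ℝ} (A B : Obs b) : star (A + B) = star A + star B :=
  congrArg MulOpposite.unop (map_add (starHom b) A B)

theorem obs_star_mul {b : ℝ} (A B : Obs b) : star (A * B) = star B * star A :=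
  congrArg MulOpposite.unop (map_mul (starHom b) A B)

theorem obs_star_smul {b : ℝ} (c : ℂ) (A : Obs b) : star (c • A) = star c • star A :=
  congrArg MulOpposite.unop (map_smul (starHom b) c A)

theorem obs_star_algebraMap {b : ℝ} (c : ℂ) :
    star (algebraMap ℂ (Obs b) c) = algebraMap ℂ (Obs b) (star c) := by
  have h1 : star (1 : Obs b) = 1 := congrArg MulOpposite.unop (map_one (starHom b))
  rw [Algebra.algebraMap_eq_smul_one, obs_star_smul, h1, Algebra.algebraMap_eq_smul_one]

theorem obs_star_star {b : ℝ} (A : Obs b) : star (star A) = A := by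
  induction A using TensorAlgebra.induction with
  | algebraMap c => rw [obs_star_algebraMap, obs_star_algebraMap, star_star]
  | ι x =>
    induction x using DirectSum.induction_on with
    | zero =>
      have h0 : (0 : Obs b) = algebraMap ℂ (Obs b) 0 := (map_zero _).symm
      rw [map_zero, h0, obs_star_algebraMap, obs_star_algebraMap, star_star]
    | of n f =>
      have hf : testConj (testConj f) = f := Subtype.ext (funext fun u => Complex.conj_conj (f.1 u))
      change star (star (smeared f n)) = smeared f n
      rw [star_smeared, star_smeared, hf]
    | add x y hx hy => rw [map_add, obs_star_add, obs_star_add, hx, hy]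
  | mul x y hx hy => rw [obs_star_mul, obs_star_mul, hx, hy]
  | add x y hx hy => rw [obs_star_add, obs_star_add, hx, hy]

instance obsStarRing (b : ℝ) : StarRing (Obs b) where
  star_involutive := obs_star_star
  star_mul := obs_star_mul
  star_add := obs_star_add

instance obsStarModule (b : ℝ) : StarModule ℂ (Obs b) := ⟨obs_star_smul⟩

/-! ### Translations and local algebras -/

/-- The translation `η_{a,θ}` of the algebra: `O_{f,n} ↦ O_{η_{a,θ} f, n}`, extended to a unital
algebra homomorphism. -/
def eta {b : ℝ} (a : ℝ) (θ : Circ) : Obs b →ₐ[ℂ] Obs b :=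
  TensorAlgebra.lift ℂ (DirectSum.toModule ℂ (Charge b) (Obs b) fun n =>
    TensorAlgebra.ι ℂ ∘ₗ DirectSum.lof ℂ (Charge b) (fun _ => TestFn) n
      ∘ₗ testTranslate a θ)

/-- The time translations `τ_t = η_{-t,0}`. -/
def tau {b : ℝ} (t : ℝ) : Obs b →ₐ[ℂ] Obs b := eta (-t) 0

/-- The local algebra of `O`: the unital `*`-subalgebra generated by the `O_{f,n}` with
`supp f ⊆ O`. -/
def localAlg (b : ℝ) (O : Set Cyl) : StarSubalgebra ℂ (Obs b) :=
  StarAlgebra.adjoin ℂ {X | ∃ (f : TestFn) (n : Charge b), tsupport f.1 ⊆ O ∧ X = smeared f n}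

/-! ### The vacuum functional -/

open Classical in
/-- The vacuum expectation `∫_{M^k} ∏ f_j(u_j) C_{bn}(u_1,…,u_k) du` of an ordered product of
`k = m + 1` basic smeared observables, as a multilinear form in the test functions. The integral is
multilinear because it converges absolutely for all test functions (if it did not, the form would
be set to `0`). -/
def smearedVEV (μ b : ℝ) {m : ℕ} (n : Fin (m + 1) → Charge b) :
    MultilinearMap ℂ (fun _ : Fin (m + 1) => TestFn) ℂ :=
  if h : ∀ f : Fin (m + 1) → TestFn, MeasureTheory.Integrable
      (fun u : Fin (m + 1) → Cyl =>
        (∏ j, (f j).1 (u j)) * chargeCorrelator μ b (fun j => (n j).1) u) then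
    { toFun := fun f => ∫ u : Fin (m + 1) → Cyl,
        (∏ j, (f j).1 (u j)) * chargeCorrelator μ b (fun j => (n j).1) u
      map_update_add' := by
        intro _ f i x y
        rw [← MeasureTheory.integral_add (h _) (h _)]
        congr 1
        funext u
        rw [← add_mul]
        congr 1
        simp only [← Finset.mul_prod_erase _ _ (Finset.mem_univ i)]
        rw [Finset.prod_congr rfl (g := fun j => (f j).1 (u j)),
          Finset.prod_congr (s₁ := Finset.univ.erase i)
            (f := fun j => (Function.update f i x j).1 (u j)) rfl
            (g := fun j => (f j).1 (u j)),
          Finset.prod_congr (s₁ := Finset.univ.erase i)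
            (f := fun j => (Function.update f i y j).1 (u j)) rfl
            (g := fun j => (f j).1 (u j))]
        · simp [add_mul]
        all_goals
          intro j hj
          rw [Function.update_of_ne (Finset.ne_of_mem_erase hj)]
      map_update_smul' := by
        intro _ f i c x
        rw [smul_eq_mul, ← MeasureTheory.integral_const_mul]
        congr 1
        funext u
        rw [← mul_assoc]
        congr 1
        simp only [← Finset.mul_prod_erase _ _ (Finset.mem_univ i)]
        rw [Finset.prod_congr rfl (g := fun j => (f j).1 (u j)),
          Finset.prod_congr (s₁ := Finset.univ.erase i)
            (f := fun j => (Function.update f i x j).1 (u j)) rfl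
            (g := fun j => (f j).1 (u j))]
        · simp [mul_assoc]
        all_goals
          intro j hj
          rw [Function.update_of_ne (Finset.ne_of_mem_erase hj)] }
  else 0

/-- The vacuum functional in degree `k`, as a multilinear form on the generators: it is `1` in
degree `0` and is expanded over the charges in positive degree. -/
def degreeForm (μ b : ℝ) : (k : ℕ) → MultilinearMap ℂ (fun _ : Fin k => Gen b) ℂ
  | 0 => MultilinearMap.constOfIsEmpty ℂ _ 1
  | m + 1 => ∑ n : Fin (m + 1) → Charge b, (smearedVEV μ b n).compLinearMap
      fun j => DirectSum.component ℂ (Charge b) (fun _ => TestFn) (n j)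

/-- The vacuum functional `ω`: `ω(1) = 1`, and the linear extension of the vacuum expectations of
ordered monomials. -/
def vacuum (μ b : ℝ) : Obs b →ₗ[ℂ] ℂ :=
  DirectSum.toModule ℂ ℕ ℂ (fun k => PiTensorProduct.lift (degreeForm μ b k))
    ∘ₗ (TensorAlgebra.toDirectSum (R := ℂ) (M := Gen b)).toLinearMap

/-! ## The state space -/

/-- `Φ(A) = (ω(B^* A))_B` in the product space `ℂ^𝒜`. -/
def Phi (μ b : ℝ) : Obs b →ₗ[ℂ] (Obs b → ℂ) where
  toFun A := fun B => vacuum μ b (star B * A)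
  map_add' A A' := by funext B; simp [mul_add]
  map_smul' c A := by funext B; simp

/-- The state space `ℋ`: the closure of `Φ(𝒜)` in the product topology. -/
def stateSpace (μ b : ℝ) : Submodule ℂ (Obs b → ℂ) :=
  (LinearMap.range (Phi μ b)).topologicalClosure

/-- `Φ` as a map into `ℋ`. -/
def vec (μ b : ℝ) : Obs b →ₗ[ℂ] stateSpace μ b :=
  (Phi μ b).codRestrict (stateSpace μ b) fun A =>
    (LinearMap.range (Phi μ b)).le_topologicalClosure ⟨A, rfl⟩

/-- The algebraic core `ℋ₀ = Φ(𝒜)`, as a subspace of `ℋ`. -/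
def core (μ b : ℝ) : Submodule ℂ (stateSpace μ b) := LinearMap.range (vec μ b)

/-- The vacuum vector `Ω = Φ(1)`. -/
def Omega (μ b : ℝ) : stateSpace μ b := vec μ b 1

/-- The pairing `(Φ(A), z) = z_A` on `ℋ₀ × ℋ`. -/
def pairing {μ b : ℝ} (u : core μ b) (z : stateSpace μ b) : ℂ :=
  z.1 (Classical.choose (LinearMap.mem_range.mp u.2))

/-- The coordinate shift `(z_A)_A ↦ (z_{C^* A})_A` on the product space. -/
def shiftCLM {b : ℝ} (C : Obs b) : (Obs b → ℂ) →L[ℂ] (Obs b → ℂ) :=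
  ContinuousLinearMap.pi fun A => ContinuousLinearMap.proj (star C * A)

theorem shift_mem {μ b : ℝ} (C : Obs b) (z : stateSpace μ b) :
    shiftCLM C z.1 ∈ stateSpace μ b := by
  refine map_mem_closure (shiftCLM C).continuous z.2 ?_
  rintro _ ⟨A, rfl⟩
  refine ⟨C * A, ?_⟩
  funext B
  change vacuum μ b (star B * (C * A)) = vacuum μ b (star (star C * B) * A)
  rw [star_mul, star_star, mul_assoc]

/-- The representation `π(C)(z_A)_A = (z_{C^* A})_A` on `ℋ`. -/
def rep {μ b : ℝ} (C : Obs b) : stateSpace μ b →L[ℂ] stateSpace μ b :=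
  ((shiftCLM C).comp (stateSpace μ b).subtypeL).codRestrict (stateSpace μ b) (shift_mem C)

/-! ## Adjointable operators and the represented local net

`ℋ →L[ℂ] ℋ` carries Mathlib's topology of uniform convergence on bounded sets. -/

/-- `T` and `S` preserve `ℋ₀` and are adjoint to each other for the pairing. -/
def IsAdjointPair {μ b : ℝ} (T S : stateSpace μ b →L[ℂ] stateSpace μ b) : Prop :=
  ∃ (hT : ∀ u ∈ core μ b, T u ∈ core μ b) (hS : ∀ u ∈ core μ b, S u ∈ core μ b),
    ∀ (u : core μ b) (z : stateSpace μ b),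
      pairing ⟨T u, hT u u.2⟩ z = pairing u (S z) ∧
      pairing ⟨S u, hS u u.2⟩ z = pairing u (T z)

/-- `End_†(ℋ)`: the continuous linear operators that have an adjoint for the pairing. -/
structure EndDagger (μ b : ℝ) where
  /-- the underlying operator -/
  op : stateSpace μ b →L[ℂ] stateSpace μ b
  /-- it has an adjoint -/
  adjointable : ∃ S, IsAdjointPair op S

/-- The adjoint `T^†`. -/
def EndDagger.dagger {μ b : ℝ} (T : EndDagger μ b) : stateSpace μ b →L[ℂ] stateSpace μ b :=
  Classical.choose T.adjointable

/-- The graph-bounded topology: `T_ν → T` iff `T_ν → T` and `T_ν^† → T^†` uniformly on bounded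
sets. -/
instance endDaggerTopology (μ b : ℝ) : TopologicalSpace (EndDagger μ b) :=
  TopologicalSpace.induced (fun T => (T.op, T.dagger)) inferInstance

/-- The represented local algebra of `O`: the closure in `End_†(ℋ)` of `π(𝒜(O))`, regarded as a
set of operators on `ℋ`. -/
def localNet (μ b : ℝ) (O : Set Cyl) : Set (stateSpace μ b →L[ℂ] stateSpace μ b) :=
  EndDagger.op '' closure {T : EndDagger μ b | ∃ C ∈ localAlg b O, T.op = rep C}

/-- The formula `U_cyl(a,θ) z = (z_{η_{-a,-θ} A})_A`, on the product space. -/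
def cylShift {b : ℝ} (a : ℝ) (θ : Circ) (z : Obs b → ℂ) : Obs b → ℂ :=
  fun A => z (eta (-a) (-θ) A)

end

end TimelikeLiouville

open TimelikeLiouville

namespace TimelikeLiouville

noncomputable section

/-! ## Reflection and translation of the Green's function and of the contour -/

/-! Two properties of the vacuum functional carry everything: it is hermitian, `vacuum_star`, and
translation invariant, `vacuum_eta`.

Hermiticity comes from a symmetry of the correlators. Reversing the order of the insertions replaces
the contour by its mirror image under `z ↦ -z̄`, traversed backwards. Time ordering is reversed as
well, so each ordered difference becomes its complex conjugate, and `g(τ̄, x)` is the conjugate of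
`g(τ, x)` for `Re τ ≥ 0`. As the charges are real, the whole correlator is conjugated
(`correlator_rev`). Invariance holds because a translation moves the contour by `ia` while only
differences enter (`correlator_translate`). Convergence of the integrals is never needed: the
default values obey the same symmetries.

The rest is formal. Hermiticity gives `Φ(A)_B = conj Φ(B)_A`, so `Φ(A) = Φ(A')` forces `z_A = z_A'`
on `Φ(𝒜)` and, by continuity of coordinates, on its closure; the pairing is thus well defined.
Pairing with `Φ(A)` reads off the `A`-th coordinate, so adjoints are unique. Invariance turns the
coordinate shift into `Φ(A) ↦ Φ(ηA)`, which preserves the closure. Conjugation by it commutes with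
`†`, is continuous for the graph-bounded topology, and carries generators supported in `O` to
generators supported in the translate of `O`, hence also the closures. -/

theorem green_neg (τ : ℂ) (x : Circ) : green τ (-x) = green τ x := by
  simp only [green, neg_neg]; ring

theorem coe_toCircle_neg (x : Circ) :
    (AddCircle.toCircle (-x) : ℂ) = starRingEnd ℂ (AddCircle.toCircle x : ℂ) := by
  rw [AddCircle.toCircle_neg, Circle.coe_inv_eq_conj]

theorem conj_log_one_sub {τ : ℂ} (hτ : 0 ≤ τ.re) (x : Circ) :
    starRingEnd ℂ (Complex.log (1 - Complex.exp (-(Real.pi * τ)) * (AddCircle.toCircle x : ℂ)))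
      = Complex.log (1 - Complex.exp (-(Real.pi * starRingEnd ℂ τ))
          * (AddCircle.toCircle (-x) : ℂ)) := by
  rw [← Complex.log_conj]
  · simp [coe_toCircle_neg, ← Complex.exp_conj]
  -- The logarithm fails to commute with conjugation only on the negative real axis; `1 - z` with
  -- `‖z‖ ≤ 1` has nonnegative real part and stays off it.
  · intro h
    rw [Complex.arg_eq_pi_iff] at h
    have h1 : ‖Complex.exp (-(Real.pi * τ)) * (AddCircle.toCircle x : ℂ)‖ ≤ 1 := by
      rw [norm_mul, Circle.norm_coe, mul_one, Complex.norm_exp]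
      simpa using mul_nonneg Real.pi_pos.le hτ
    have h2 := (Complex.re_le_norm _).trans h1
    have h3 := h.1
    rw [Complex.sub_re, Complex.one_re] at h3
    linarith

theorem conj_green {τ : ℂ} (hτ : 0 ≤ τ.re) (x : Circ) :
    starRingEnd ℂ (green τ x) = green (starRingEnd ℂ τ) x := by
  simp only [green, map_sub, map_mul, map_neg, map_div₀, conj_log_one_sub hτ, neg_neg, map_one,
    map_ofNat, Complex.conj_ofReal]
  ring

/-- Reflection `τ ↦ -τ̄` of the complexified time. -/
def timeReflect (p : ℂ × Circ) : ℂ × Circ := (-starRingEnd ℂ p.1, p.2)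

theorem orderedGreen_comm {s s' : ℝ} {p p' : ℂ × Circ} (h : s = s' → p.1 = p'.1) :
    orderedGreen s p s' p' = orderedGreen s' p' s p := by
  unfold orderedGreen
  rcases lt_trichotomy s s' with hs | hs | hs
  · rw [if_pos hs, if_neg hs.not_gt]
  · subst hs
    rw [if_neg (lt_irrefl _), if_neg (lt_irrefl _), h rfl, ← neg_sub p'.2, green_neg]
  · rw [if_pos hs, if_neg hs.not_gt]

/-- Both `s ↦ c - s` and the reflection reverse a difference; together they only conjugate it. The
monotonicity hypotheses keep the ordered difference in `Re τ ≥ 0`. At equal parameters the order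
does not flip, and evenness in `x` takes over. -/
theorem conj_orderedGreen {s s' : ℝ} {p p' : ℂ × Circ} (c : ℝ)
    (h : s ≤ s' → p.1.re ≤ p'.1.re) (h' : s' ≤ s → p'.1.re ≤ p.1.re) (he : s = s' → p.1 = p'.1) :
    starRingEnd ℂ (orderedGreen s p s' p')
      = orderedGreen (c - s) (timeReflect p) (c - s') (timeReflect p') := by
  unfold orderedGreen timeReflect
  rcases lt_trichotomy s s' with hs | hs | hs
  · rw [if_pos hs, if_neg (by linarith), conj_green (by simpa using h hs.le), ← neg_sub p.2,
      green_neg, map_sub]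
    congr 1; ring
  · subst hs
    rw [if_neg (lt_irrefl _), if_neg (lt_irrefl _), he rfl, conj_green (by simp)]
    simp
  · rw [if_neg hs.not_gt, if_pos (by linarith), conj_green (by simpa using h' hs.le),
      ← neg_sub p'.2, green_neg, map_sub]
    congr 1; ring

theorem orderedGreen_add (s s' : ℝ) (p p' q : ℂ × Circ) :
    orderedGreen s (p + q) s' (p' + q) = orderedGreen s p s' p' := by
  simp [orderedGreen]

/-- The vertical component of the contour visits `t j` at the parameter `j`. -/
theorem contour_height {m : ℕ} (t : Fin (m + 1) → ℝ) (j : Fin (m + 1)) :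
    t 0 + ∑ i : Fin m, (t i.succ - t i.castSucc) * max 0 (min 1 (((j : ℕ) : ℝ) - (i : ℕ)))
      = t j := by
  induction j using Fin.induction with
  | zero =>
    rw [Finset.sum_eq_zero, add_zero]
    intro i _
    have : (0 : ℝ) ≤ ((i : ℕ) : ℝ) := Nat.cast_nonneg _
    rw [max_eq_left, mul_zero]
    exact (min_le_right _ _).trans (by simp)
  | succ k ih =>
    -- Raising the parameter from `k` to `k + 1` changes only the `k`-th clamp, from `0` to `1`.
    have hstep : ∀ i : Fin m,
        (t i.succ - t i.castSucc) * max 0 (min 1 (((k.succ : ℕ) : ℝ) - (i : ℕ)))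
          = (t i.succ - t i.castSucc) * max 0 (min 1 (((k.castSucc : ℕ) : ℝ) - (i : ℕ)))
            + if i = k then t k.succ - t k.castSucc else 0 := by
      intro i
      rcases lt_trichotomy i k with h | h | h
      · have h1 : ((i : ℕ) : ℝ) + 1 ≤ (k : ℕ) := by exact_mod_cast h
        rw [if_neg h.ne, add_zero, min_eq_left, min_eq_left] <;> simp <;> linarith
      · subst h; simp
      · have h1 : ((k : ℕ) : ℝ) + 1 ≤ (i : ℕ) := by exact_mod_cast h
        rw [if_neg h.ne', add_zero, max_eq_left, max_eq_left] <;>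
          refine (min_le_right _ _).trans ?_ <;>
          simp only [Fin.val_succ, Fin.val_castSucc, Nat.cast_add, Nat.cast_one] <;> linarith
    rw [Finset.sum_congr rfl fun i _ => hstep i, Finset.sum_add_distrib, ← add_assoc, ih]
    simp

theorem contour_natCast {m : ℕ} (t : Fin (m + 1) → ℝ) (j : Fin (m + 1)) :
    contour t ((j : ℕ) : ℝ) = Complex.I * (t j : ℂ) := by
  have h : ((j : ℕ) : ℝ) ≤ m := by exact_mod_cast Nat.lt_succ_iff.mp j.2
  rw [contour, contour_height, min_eq_right (Nat.cast_nonneg _), max_eq_right (by linarith)]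
  simp

theorem contour_re {m : ℕ} (t : Fin (m + 1) → ℝ) (s : ℝ) :
    (contour t s).re = min s 0 + max (s - m) 0 := by
  simp [contour]

theorem contour_re_mono {m : ℕ} (t : Fin (m + 1) → ℝ) : Monotone fun s => (contour t s).re := by
  intro s s' h
  simp only [contour_re]
  gcongr

theorem clamp_one_sub (x : ℝ) : max 0 (min 1 (1 - x)) = 1 - max 0 (min 1 x) := by
  grind

/-- The reflection fixes heights and exchanges the two horizontal ends, which is what running the
contour backwards undoes. -/
theorem contour_rev {m : ℕ} (t : Fin (m + 1) → ℝ) (s : ℝ) :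
    contour (fun j => t j.rev) s = -starRingEnd ℂ (contour t (m - s)) := by
  have hre : min s 0 + max (s - m) 0 = -(min ((m : ℝ) - s) 0 + max ((m : ℝ) - s - m) 0) := by
    grind
  have him : t (Fin.rev 0) + ∑ j : Fin m, (t (Fin.rev j.succ) - t (Fin.rev j.castSucc))
        * max 0 (min 1 (s - (j : ℕ)))
      = t 0 + ∑ j : Fin m, (t j.succ - t j.castSucc) * max 0 (min 1 ((m : ℝ) - s - (j : ℕ))) := by
    have htel : t 0 + ∑ i : Fin m, (t i.succ - t i.castSucc) = t (Fin.last m) := by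
      rw [← contour_height t (Fin.last m)]
      congr 1
      refine Finset.sum_congr rfl fun i _ => ?_
      have h1 : ((i : ℕ) : ℝ) + 1 ≤ m := by exact_mod_cast i.2
      rw [Fin.val_last, min_eq_left (by linarith), max_eq_right zero_le_one, mul_one]
    -- Under reversal each increment changes sign and its clamp `c` becomes `1 - c`; the surplus
    -- telescopes to `t_m - t_0`.
    rw [← Equiv.sum_comp Fin.revPerm]
    have : ∀ i : Fin m, (t (Fin.rev (Fin.revPerm i).succ) - t (Fin.rev (Fin.revPerm i).castSucc))
          * max 0 (min 1 (s - ((Fin.revPerm i : Fin m) : ℕ)))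
        = (t i.succ - t i.castSucc) * max 0 (min 1 ((m : ℝ) - s - (i : ℕ)))
          - (t i.succ - t i.castSucc) := by
      intro i
      have h2 : s - ((Fin.revPerm i : Fin m) : ℕ) = 1 - ((m : ℝ) - s - (i : ℕ)) := by
        rw [Fin.revPerm_apply, Fin.val_rev, Nat.cast_sub i.2]
        push_cast; ring
      rw [h2, clamp_one_sub, Fin.revPerm_apply, Fin.rev_succ, Fin.rev_castSucc, Fin.rev_rev]
      ring
    rw [Finset.sum_congr rfl fun i _ => this i, Finset.sum_sub_distrib, Fin.rev_zero, ← htel]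
    ring
  rw [contour, contour, him, hre]
  apply Complex.ext <;> simp

/-- The sign of the reflection cancels the one from `s ↦ m - s`. The derivative rules used need no
differentiability, so corners are covered. -/
theorem deriv_contour_rev {m : ℕ} (t : Fin (m + 1) → ℝ) (s : ℝ) :
    deriv (contour fun j => t j.rev) s = starRingEnd ℂ (deriv (contour t) (m - s)) := by
  have h : contour (fun j => t j.rev) = fun s => -(star (fun s => contour t (m - s))) s :=
    funext fun s => contour_rev t s
  rw [h, deriv.fun_neg]
  change -deriv (fun s => star (contour t (m - s))) s = _
  rw [deriv.star, deriv_comp_const_sub, star_neg, neg_neg]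
  rfl

theorem contour_add {m : ℕ} (t : Fin (m + 1) → ℝ) (a s : ℝ) :
    contour (fun j => t j + a) s = contour t s + Complex.I * a := by
  simp only [contour, add_sub_add_right_eq_sub]
  push_cast
  ring

theorem deriv_contour_add {m : ℕ} (t : Fin (m + 1) → ℝ) (a s : ℝ) :
    deriv (contour fun j => t j + a) s = deriv (contour t) s := by
  rw [funext (contour_add t a), deriv_add_const]

/-! ## Reflection and translation of the correlators -/

/-- Reversal turns pairs `j < j'` into pairs `j > j'`; symmetry of the summand turns them back. -/
theorem sum_Ioi_rev {k : ℕ} (F : Fin k → Fin k → ℂ) (hF : ∀ i j, F i j = F j i) :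
    ∑ j : Fin k, ∑ j' ∈ Finset.Ioi j, F j.rev j'.rev = ∑ j, ∑ j' ∈ Finset.Ioi j, F j j' := by
  have h : ∀ G : Fin k → Fin k → ℂ,
      ∑ j, ∑ j' ∈ Finset.Ioi j, G j j' = ∑ j, ∑ j', if j < j' then G j j' else 0 := by
    intro G
    refine Finset.sum_congr rfl fun j _ => ?_
    rw [← Finset.sum_filter]
    congr 1
    ext; simp
  rw [h, h, Finset.sum_comm, ← Equiv.sum_comp Fin.revPerm]
  refine Finset.sum_congr rfl fun j _ => ?_
  rw [← Equiv.sum_comp Fin.revPerm]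
  refine Finset.sum_congr rfl fun j' _ => ?_
  simp only [Fin.revPerm_apply, Fin.rev_rev, Fin.rev_lt_rev, hF j j']

/-- Reversing the order of the insertions conjugates a correlator with real charges. -/
theorem correlator_rev (μ b : ℝ) {m : ℕ} (α : Fin (m + 1) → ℂ)
    (hα : ∀ j, starRingEnd ℂ (α j) = α j) (w : ℕ) (u : Fin (m + 1) → Cyl) :
    correlator μ b (fun j => α j.rev) w (fun j => u j.rev)
      = starRingEnd ℂ (correlator μ b α w u) := by
  set t : Fin (m + 1) → ℝ := fun j => (u j).1 with ht
  -- Writing the insertions as contour points at the parameters `j` lets one conjugation rule,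
  -- `hgr`, serve insertions and screening points alike.
  set v : Fin (m + 1) → ℂ × Circ := fun j => (contour t ((j : ℕ) : ℝ), (u j).2) with hv
  have hv' : ∀ j, (Complex.I * ((u j).1 : ℂ), (u j).2) = v j := fun j => by
    rw [hv]; simp only [contour_natCast]; rfl
  have hcast : ∀ j : Fin (m + 1), ((j.rev : ℕ) : ℝ) = m - ((j : ℕ) : ℝ) := fun j => by
    rw [Fin.val_rev, Nat.cast_sub j.2]; push_cast; ring
  have hcast' : ∀ j : Fin (m + 1), ((j : ℕ) : ℝ) = m - ((j.rev : ℕ) : ℝ) := fun j => by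
    rw [hcast]; ring
  have hrefl : ∀ j, v j = timeReflect (v j) := fun j => by
    rw [← hv', timeReflect]; simp
  have hgr : ∀ (s s' : ℝ) (x x' : Circ),
      starRingEnd ℂ (orderedGreen s (contour t s, x) s' (contour t s', x'))
        = orderedGreen (m - s) (timeReflect (contour t s, x)) (m - s')
            (timeReflect (contour t s', x')) := fun s s' x x' =>
    conj_orderedGreen m (fun h => contour_re_mono t h) (fun h => contour_re_mono t h)
      (fun h => by rw [h])
  have hsymm : ∀ i j, α i * α j * orderedGreen ((i : ℕ) : ℝ) (v i) ((j : ℕ) : ℝ) (v j)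
      = α j * α i * orderedGreen ((j : ℕ) : ℝ) (v j) ((i : ℕ) : ℝ) (v i) := fun i j => by
    rw [mul_comm (α i), orderedGreen_comm fun h => by simp only [hv, h]]
  have hpre : starRingEnd ℂ (∑ j, ∑ j' ∈ Finset.Ioi j,
        α j * α j' * orderedGreen ((j : ℕ) : ℝ) (v j) ((j' : ℕ) : ℝ) (v j'))
      = ∑ j : Fin (m + 1), ∑ j' ∈ Finset.Ioi j, α j.rev * α j'.rev
          * orderedGreen ((j : ℕ) : ℝ) (v j.rev) ((j' : ℕ) : ℝ) (v j'.rev) := by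
    rw [← sum_Ioi_rev _ hsymm]
    simp only [map_sum, map_mul, hα]
    refine Finset.sum_congr rfl fun j _ => Finset.sum_congr rfl fun j' _ => ?_
    have h := hgr ((j.rev : ℕ) : ℝ) ((j'.rev : ℕ) : ℝ) (u j.rev).2 (u j'.rev).2
    change _ = orderedGreen _ (timeReflect (v j.rev)) _ (timeReflect (v j'.rev)) at h
    rw [← hrefl, ← hrefl, ← hcast', ← hcast'] at h
    rw [← h]
  unfold correlator
  simp only [hv', map_mul, map_div₀, map_pow, map_neg, Complex.conj_ofReal, Complex.conj_natCast,
    ← Complex.exp_conj, map_ofNat, hpre]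
  congr 1
  rw [← integral_conj]
  refine MeasureTheory.integral_congr_ae (.of_forall fun y => ?_)
  simp only
  -- Substitute `s ↦ m - s` in every screening parameter.
  rw [← integral_conj, ← MeasureTheory.integral_sub_left_eq_self _ _ (fun _ : Fin w => (m : ℝ))]
  refine MeasureTheory.integral_congr_ae (.of_forall fun s => ?_)
  simp only [map_mul, map_sub, map_sum, map_prod, map_neg, map_pow, Complex.conj_ofReal,
    map_ofNat, ← Complex.exp_conj, Pi.sub_apply, hα]
  have hcon : ∀ l, contour (fun j => t j.rev) (m - s l) = -starRingEnd ℂ (contour t (s l)) :=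
    fun l => by rw [contour_rev, sub_sub_cancel]
  have hA : ∑ j : Fin (m + 1), ∑ l : Fin w, α j.rev * orderedGreen ((j : ℕ) : ℝ) (v j.rev)
        (m - s l) (contour (fun j => t j.rev) (m - s l), y l)
      = ∑ j, ∑ l, α j * starRingEnd ℂ (orderedGreen ((j : ℕ) : ℝ) (v j) (s l)
          (contour t (s l), y l)) := by
    rw [← Equiv.sum_comp Fin.revPerm]
    refine Finset.sum_congr rfl fun j _ => Finset.sum_congr rfl fun l _ => ?_
    rw [Fin.revPerm_apply, Fin.rev_rev, hv, hgr, hcon, hcast]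
    change _ = α j * orderedGreen _ (timeReflect (v j)) _ _
    rw [← hrefl]
    rfl
  have hB : ∑ l : Fin w, ∑ l' ∈ Finset.Ioi l,
        orderedGreen (m - s l) (contour (fun j => t j.rev) (m - s l), y l)
          (m - s l') (contour (fun j => t j.rev) (m - s l'), y l')
      = ∑ l, ∑ l' ∈ Finset.Ioi l, starRingEnd ℂ (orderedGreen (s l) (contour t (s l), y l)
          (s l') (contour t (s l'), y l')) := by
    refine Finset.sum_congr rfl fun l _ => Finset.sum_congr rfl fun l' _ => ?_
    rw [hgr, hcon, hcon]
    rfl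
  have hC : ∀ l, deriv (contour fun j => t j.rev) (m - s l)
      = starRingEnd ℂ (deriv (contour t) (s l)) := fun l => by
    rw [deriv_contour_rev, sub_sub_cancel]
  simp only [ht] at hA hB hC
  rw [hA, hB, Finset.prod_congr rfl fun l _ => hC l]

theorem chargeCorrelator_rev (μ b : ℝ) {m : ℕ} (n : Fin (m + 1) → ℤ) (u : Fin (m + 1) → Cyl) :
    chargeCorrelator μ b (fun j => n j.rev) (fun j => u j.rev)
      = starRingEnd ℂ (chargeCorrelator μ b n u) := by
  have h : ∑ j, n (Fin.rev j) = ∑ j, n j := Equiv.sum_comp Fin.revPerm n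
  unfold chargeCorrelator
  rw [h]
  split_ifs
  · exact correlator_rev μ b (fun j => (b : ℂ) * (n j : ℂ)) (fun j => by simp) _ u
  · simp

theorem correlator_translate (μ b : ℝ) {m : ℕ} (α : Fin (m + 1) → ℂ) (w : ℕ)
    (u : Fin (m + 1) → Cyl) (a : ℝ) (θ : Circ) :
    correlator μ b α w (fun j => cylTranslate a θ (u j)) = correlator μ b α w u := by
  have hv : ∀ j, ((Complex.I * ((cylTranslate a θ (u j)).1 : ℂ), (cylTranslate a θ (u j)).2) :
      ℂ × Circ) = (Complex.I * ((u j).1 : ℂ), (u j).2) + (Complex.I * a, θ) := fun j => by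
    simp [cylTranslate, mul_add]
  have hc : ∀ (s : ℝ) (y : Circ),
      (contour (fun j => (cylTranslate a θ (u j)).1) s, y + θ)
        = (contour (fun j => (u j).1) s, y) + (Complex.I * a, θ) := fun s y => by
    simp only [cylTranslate]
    rw [contour_add]; rfl
  have hd : ∀ s : ℝ, deriv (contour fun j => (cylTranslate a θ (u j)).1) s
      = deriv (contour fun j => (u j).1) s := fun s => deriv_contour_add _ a s
  unfold correlator
  simp only [hv, hd, orderedGreen_add]
  congr 1
  -- Only the circle variables need a shift: the contour itself moves by `ia` at fixed parameter.
  rw [← MeasureTheory.integral_add_right_eq_self _ (fun _ : Fin w => θ)]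
  simp only [Pi.add_apply, hc, orderedGreen_add]

theorem chargeCorrelator_translate (μ b : ℝ) {m : ℕ} (n : Fin (m + 1) → ℤ)
    (u : Fin (m + 1) → Cyl) (a : ℝ) (θ : Circ) :
    chargeCorrelator μ b n (fun j => cylTranslate a θ (u j)) = chargeCorrelator μ b n u := by
  unfold chargeCorrelator
  rw [correlator_translate]

/-! ## Hermiticity and translation invariance of the vacuum functional -/

theorem smearedVEV_rev (μ b : ℝ) {m : ℕ} (n : Fin (m + 1) → Charge b)
    (f : Fin (m + 1) → TestFn) :
    smearedVEV μ b (fun j => n j.rev) (fun j => testConj (f j.rev))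
      = starRingEnd ℂ (smearedVEV μ b n f) := by
  have hmp : MeasureTheory.MeasurePreserving
      (MeasurableEquiv.piCongrLeft (fun _ : Fin (m + 1) => Cyl) Fin.revPerm) :=
    MeasureTheory.volume_measurePreserving_piCongrLeft _ _
  have happly : ∀ u : Fin (m + 1) → Cyl,
      MeasurableEquiv.piCongrLeft (fun _ : Fin (m + 1) => Cyl) Fin.revPerm u
        = fun j => u j.rev := fun u => by
    funext j
    rw [← Fin.rev_rev j]
    exact (Equiv.piCongrLeft_apply_apply (fun _ : Fin (m + 1) => Cyl) Fin.revPerm u j.rev).trans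
      (by rw [Fin.rev_rev])
  have hpt : ∀ (g : Fin (m + 1) → TestFn) (u : Fin (m + 1) → Cyl),
      (∏ j : Fin (m + 1), (testConj (g j.rev)).1 (u j.rev))
          * chargeCorrelator μ b (fun j => (n j.rev).1) (fun j => u j.rev)
        = starRingEnd ℂ ((∏ j, (g j).1 (u j)) * chargeCorrelator μ b (fun j => (n j).1) u) := by
    intro g u
    rw [map_mul, map_prod, ← Equiv.prod_comp Fin.revPerm (fun j => starRingEnd ℂ ((g j).1 (u j))),
      chargeCorrelator_rev μ b (fun j => (n j).1) u]
    rfl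
  -- Both forms must take the same branch of the definition, the integral or the default `0`.
  have hint : (∀ g : Fin (m + 1) → TestFn, MeasureTheory.Integrable
        (fun u : Fin (m + 1) → Cyl =>
          (∏ j, (g j).1 (u j)) * chargeCorrelator μ b (fun j => (n j.rev).1) u)) ↔
      ∀ g : Fin (m + 1) → TestFn, MeasureTheory.Integrable
        (fun u : Fin (m + 1) → Cyl =>
          (∏ j, (g j).1 (u j)) * chargeCorrelator μ b (fun j => (n j).1) u) := by
    have hone : ∀ g : Fin (m + 1) → TestFn, MeasureTheory.Integrable
          (fun u : Fin (m + 1) → Cyl => (∏ j, (testConj (g j.rev)).1 (u j))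
            * chargeCorrelator μ b (fun j => (n j.rev).1) u) ↔
        MeasureTheory.Integrable (fun u : Fin (m + 1) → Cyl =>
          (∏ j, (g j).1 (u j)) * chargeCorrelator μ b (fun j => (n j).1) u) := by
      intro g
      rw [← hmp.integrable_comp_emb (MeasurableEquiv.measurableEmbedding _)]
      simp only [Function.comp_def, happly, hpt]
      exact ⟨fun h => by simpa using Complex.conjLIE.integrable_comp_iff.mp h,
        fun h => Complex.conjLIE.integrable_comp_iff.mpr h⟩
    refine ⟨fun h g => (hone g).mp (h _), fun h g => ?_⟩
    have h2 := (hone fun j => testConj (g j.rev)).mpr (h _)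
    have hg : ∀ j : Fin (m + 1), testConj (testConj (g j)) = g j := fun j =>
      Subtype.ext (funext fun u => Complex.conj_conj _)
    simpa only [Fin.rev_rev, hg] using h2
  unfold smearedVEV
  by_cases h : ∀ g : Fin (m + 1) → TestFn, MeasureTheory.Integrable
        (fun u : Fin (m + 1) → Cyl =>
          (∏ j, (g j).1 (u j)) * chargeCorrelator μ b (fun j => (n j).1) u)
  · rw [dif_pos h, dif_pos (hint.mpr h)]
    change ∫ u : Fin (m + 1) → Cyl, (∏ j, (testConj (f j.rev)).1 (u j))
        * chargeCorrelator μ b (fun j => (n j.rev).1) u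
      = starRingEnd ℂ (∫ u : Fin (m + 1) → Cyl,
        (∏ j, (f j).1 (u j)) * chargeCorrelator μ b (fun j => (n j).1) u)
    rw [← integral_conj, ← hmp.integral_comp (MeasurableEquiv.measurableEmbedding _)]
    simp only [happly, hpt]
  · rw [dif_neg h, dif_neg (mt hint.mp h)]
    simp

theorem smearedVEV_translate (μ b : ℝ) {m : ℕ} (n : Fin (m + 1) → Charge b)
    (f : Fin (m + 1) → TestFn) (a : ℝ) (θ : Circ) :
    smearedVEV μ b n (fun j => testTranslate a θ (f j)) = smearedVEV μ b n f := by
  unfold smearedVEV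
  -- The integrability condition ranges over all test functions, so it is the same on both sides.
  split_ifs with h
  · change ∫ u : Fin (m + 1) → Cyl, (∏ j, (f j).1 (cylTranslate (-a) (-θ) (u j)))
        * chargeCorrelator μ b (fun j => (n j).1) u
      = ∫ u : Fin (m + 1) → Cyl,
        (∏ j, (f j).1 (u j)) * chargeCorrelator μ b (fun j => (n j).1) u
    have : (MeasureTheory.volume : MeasureTheory.Measure Cyl).IsAddLeftInvariant :=
      inferInstanceAs ((MeasureTheory.volume : MeasureTheory.Measure ℝ).prod
        (MeasureTheory.volume : MeasureTheory.Measure Circ)).IsAddLeftInvariant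
    rw [← MeasureTheory.integral_add_right_eq_self
      (fun u : Fin (m + 1) → Cyl =>
        (∏ j, (f j).1 (u j)) * chargeCorrelator μ b (fun j => (n j).1) u)
      (fun _ => ((-a, -θ) : Cyl))]
    refine MeasureTheory.integral_congr_ae (.of_forall fun u => ?_)
    simp only
    rw [← chargeCorrelator_translate μ b _ u (-a) (-θ)]
    rfl
  · rfl

/-- Conjugation of the test functions in a generator. -/
def genConj (b : ℝ) : Gen b →+ Gen b :=
  DirectSum.map fun _ =>
    { toFun := testConj
      map_zero' := Subtype.ext (funext fun _ => map_zero (starRingEnd ℂ))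
      map_add' := fun f g => Subtype.ext (funext fun u =>
        map_add (starRingEnd ℂ) (f.1 u) (g.1 u)) }

/-- Translation of the test functions in a generator. -/
def genTranslate (b a : ℝ) (θ : Circ) : Gen b →ₗ[ℂ] Gen b :=
  DirectSum.lmap fun _ => testTranslate a θ

theorem star_ι {b : ℝ} (x : Gen b) :
    star (TensorAlgebra.ι ℂ x) = TensorAlgebra.ι ℂ (genConj b x) := by
  induction x using DirectSum.induction_on with
  | zero => simp
  | of n f =>
    change star (smeared f n) = _
    rw [star_smeared, genConj, DirectSum.map_of]
    rfl
  | add x y hx hy => rw [map_add, star_add, hx, hy, map_add, map_add]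

theorem eta_ι {b : ℝ} (a : ℝ) (θ : Circ) (x : Gen b) :
    eta a θ (TensorAlgebra.ι ℂ x) = TensorAlgebra.ι ℂ (genTranslate b a θ x) := by
  have h : (eta a θ : Obs b →ₐ[ℂ] Obs b).toLinearMap ∘ₗ TensorAlgebra.ι ℂ
      = TensorAlgebra.ι ℂ ∘ₗ genTranslate b a θ := by
    refine DirectSum.linearMap_ext ℂ fun n => LinearMap.ext fun f => ?_
    simp [eta, genTranslate]
  exact LinearMap.congr_fun h x

theorem star_list_prod_reverse {R : Type*} [Semiring R] [StarRing R] (l : List R) :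
    star l.prod = (l.reverse.map star).prod := by
  induction l with
  | nil => simp
  | cons x l ih => simp [star_mul, ih]

theorem star_tprod {b : ℝ} {k : ℕ} (x : Fin k → Gen b) :
    star (TensorAlgebra.tprod ℂ (Gen b) k x)
      = TensorAlgebra.tprod ℂ (Gen b) k fun i => genConj b (x i.rev) := by
  rw [TensorAlgebra.tprod_apply, TensorAlgebra.tprod_apply, star_list_prod_reverse]
  congr 1
  refine List.ext_getElem (by simp) fun i h₁ h₂ => ?_
  simp only [List.getElem_map, List.getElem_reverse, List.getElem_ofFn, star_ι]
  congr 3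
  ext
  simp [Fin.val_rev, Nat.sub_sub, Nat.add_comm]

theorem eta_tprod {b : ℝ} (a : ℝ) (θ : Circ) {k : ℕ} (x : Fin k → Gen b) :
    eta a θ (TensorAlgebra.tprod ℂ (Gen b) k x)
      = TensorAlgebra.tprod ℂ (Gen b) k fun i => genTranslate b a θ (x i) := by
  rw [TensorAlgebra.tprod_apply, TensorAlgebra.tprod_apply, map_list_prod, List.map_ofFn]
  congr 2
  funext i
  exact eta_ι a θ _

/-- The vacuum functional is defined degree by degree and is not multiplicative, so induction runs
over sums of scaled pure tensors. -/
theorem tensorAlgebra_tprod_induction {R M : Type*} [CommSemiring R] [AddCommMonoid M]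
    [Module R M] {p : TensorAlgebra R M → Prop}
    (smul_tprod : ∀ (c : R) (k : ℕ) (x : Fin k → M), p (c • TensorAlgebra.tprod R M k x))
    (add : ∀ A B, p A → p B → p (A + B)) (A : TensorAlgebra R M) : p A := by
  rw [← TensorAlgebra.ofDirectSum_toDirectSum A]
  induction TensorAlgebra.toDirectSum A using DirectSum.induction_on with
  | zero => simpa using smul_tprod 0 0 0
  | of k z =>
    induction z using PiTensorProduct.induction_on with
    | smul_tprod c x =>
      have := smul_tprod c k x
      rwa [← TensorAlgebra.ofDirectSum_of_tprod, ← map_smul, ← DirectSum.lof_eq_of R,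
        ← map_smul, DirectSum.lof_eq_of] at this
    | add x y hx hy => rw [map_add, map_add]; exact add _ _ hx hy
  | add x y hx hy => rw [map_add]; exact add _ _ hx hy

theorem vacuum_tprod (μ b : ℝ) {k : ℕ} (x : Fin k → Gen b) :
    vacuum μ b (TensorAlgebra.tprod ℂ (Gen b) k x) = degreeForm μ b k x := by
  change DirectSum.toModule ℂ ℕ ℂ _ (TensorAlgebra.toDirectSum _) = _
  rw [TensorAlgebra.toDirectSum_tensorPower_tprod, ← DirectSum.lof_eq_of ℂ,
    DirectSum.toModule_lof, PiTensorProduct.lift.tprod]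

theorem degreeForm_succ (μ b : ℝ) {m : ℕ} (x : Fin (m + 1) → Gen b) :
    degreeForm μ b (m + 1) x
      = ∑ n : Fin (m + 1) → Charge b, smearedVEV μ b n fun j => x j (n j) := by
  simp only [degreeForm, sum_apply]
  rfl

theorem degreeForm_rev (μ b : ℝ) {k : ℕ} (x : Fin k → Gen b) :
    degreeForm μ b k (fun i => genConj b (x i.rev)) = starRingEnd ℂ (degreeForm μ b k x) := by
  cases k with
  | zero => simp [degreeForm]
  | succ m =>
    -- The charge assignments summed over are reversed along with the factors.
    rw [degreeForm_succ, degreeForm_succ, map_sum,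
      ← Equiv.sum_comp (Equiv.arrowCongr Fin.revPerm (Equiv.refl (Charge b)))]
    refine Finset.sum_congr rfl fun n _ => ?_
    rw [← smearedVEV_rev]
    congr 1

theorem degreeForm_translate (μ b : ℝ) {k : ℕ} (x : Fin k → Gen b) (a : ℝ) (θ : Circ) :
    degreeForm μ b k (fun i => genTranslate b a θ (x i)) = degreeForm μ b k x := by
  cases k with
  | zero => simp [degreeForm]
  | succ m =>
    rw [degreeForm_succ, degreeForm_succ]
    exact Finset.sum_congr rfl fun n _ => smearedVEV_translate μ b n (fun j => x j (n j)) a θ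

/-- The vacuum functional is hermitian. -/
theorem vacuum_star (μ b : ℝ) (A : Obs b) :
    vacuum μ b (star A) = starRingEnd ℂ (vacuum μ b A) := by
  induction A using tensorAlgebra_tprod_induction with
  | smul_tprod c k x =>
    rw [star_smul, map_smul, map_smul, star_tprod, vacuum_tprod, vacuum_tprod, degreeForm_rev,
      smul_eq_mul, smul_eq_mul, map_mul]
    rfl
  | add A B hA hB => rw [star_add, map_add, map_add, map_add, hA, hB]

/-- The vacuum functional is translation invariant. -/
theorem vacuum_eta (μ b : ℝ) (a : ℝ) (θ : Circ) (A : Obs b) :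
    vacuum μ b (eta a θ A) = vacuum μ b A := by
  induction A using tensorAlgebra_tprod_induction with
  | smul_tprod c k x =>
    rw [map_smul, map_smul, map_smul, eta_tprod, vacuum_tprod, vacuum_tprod, degreeForm_translate]
  | add A B hA hB => rw [map_add, map_add, map_add, hA, hB]

/-! ## Translations as a group of `*`-automorphisms -/

theorem eta_smeared {b : ℝ} (a : ℝ) (θ : Circ) (f : TestFn) (n : Charge b) :
    eta a θ (smeared f n) = smeared (testTranslate a θ f) n := by
  rw [smeared, eta_ι, genTranslate, DirectSum.lmap_lof]
  rfl

theorem eta_star {b : ℝ} (a : ℝ) (θ : Circ) (A : Obs b) :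
    eta a θ (star A) = star (eta a θ A) := by
  have hg : ∀ x : Gen b, genTranslate b a θ (genConj b x) = genConj b (genTranslate b a θ x) := by
    intro x
    refine DFinsupp.ext fun n => ?_
    change genTranslate b a θ (genConj b x) n = genConj b (genTranslate b a θ x) n
    rw [genTranslate, genConj, DirectSum.lmap_apply, DirectSum.map_apply, DirectSum.map_apply,
      DirectSum.lmap_apply]
    rfl
  induction A using tensorAlgebra_tprod_induction with
  | smul_tprod c k x =>
    rw [star_smul, map_smul, map_smul, star_smul, star_tprod, eta_tprod, eta_tprod, star_tprod]
    simp only [hg]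
  | add A B hA hB => rw [star_add, map_add, map_add, star_add, hA, hB]

theorem eta_zero {b : ℝ} (A : Obs b) : eta 0 0 A = A := by
  have h : (eta 0 0 : Obs b →ₐ[ℂ] Obs b) = AlgHom.id ℂ (Obs b) := by
    refine TensorAlgebra.hom_ext (DirectSum.linearMap_ext ℂ fun n => LinearMap.ext fun f => ?_)
    change eta 0 0 (smeared f n) = smeared f n
    rw [eta_smeared]
    congr 1
    refine Subtype.ext (funext fun u => ?_)
    change f.1 (cylTranslate (-0) (-0) u) = f.1 u
    simp [cylTranslate]
  exact AlgHom.congr_fun h A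

theorem eta_add {b : ℝ} (a a' : ℝ) (θ θ' : Circ) (A : Obs b) :
    eta (a + a') (θ + θ') A = eta a θ (eta a' θ' A) := by
  have h : (eta (a + a') (θ + θ') : Obs b →ₐ[ℂ] Obs b) = (eta a θ).comp (eta a' θ') := by
    refine TensorAlgebra.hom_ext (DirectSum.linearMap_ext ℂ fun n => LinearMap.ext fun f => ?_)
    change eta (a + a') (θ + θ') (smeared f n) = eta a θ (eta a' θ' (smeared f n))
    rw [eta_smeared, eta_smeared, eta_smeared]
    congr 1
    refine Subtype.ext (funext fun u => ?_)
    change f.1 (cylTranslate (-(a + a')) (-(θ + θ')) u)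
      = f.1 (cylTranslate (-a') (-θ') (cylTranslate (-a) (-θ) u))
    simp only [cylTranslate, neg_add, add_assoc]
  exact AlgHom.congr_fun h A

theorem eta_eta_neg {b : ℝ} (a : ℝ) (θ : Circ) (A : Obs b) : eta a θ (eta (-a) (-θ) A) = A := by
  rw [← eta_add, add_neg_cancel, add_neg_cancel, eta_zero]

/-- The translation as a `*`-homomorphism. -/
def etaStarHom (b a : ℝ) (θ : Circ) : Obs b →⋆ₐ[ℂ] Obs b :=
  { eta a θ with map_star' := eta_star a θ }

theorem eta_mem_localAlg {b : ℝ} (a : ℝ) (θ : Circ) {O : Set Cyl} {A : Obs b}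
    (hA : A ∈ localAlg b O) : eta a θ A ∈ localAlg b (cylTranslate a θ '' O) := by
  have h : localAlg b O ≤ (localAlg b (cylTranslate a θ '' O)).comap (etaStarHom b a θ) := by
    refine StarAlgebra.adjoin_le ?_
    rintro _ ⟨f, n, hf, rfl⟩
    refine StarAlgebra.subset_adjoin ℂ _ ⟨testTranslate a θ f, n, ?_, eta_smeared a θ f n⟩
    have hsupp : tsupport (testTranslate a θ f).1
        ⊆ cylTranslate (-a) (-θ) ⁻¹' tsupport f.1 :=
      tsupport_comp_subset_preimage f.1 (f := cylTranslate (-a) (-θ)) (by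
        unfold cylTranslate; fun_prop)
    intro u hu
    refine ⟨cylTranslate (-a) (-θ) u, hf (hsupp hu), ?_⟩
    simp [cylTranslate]
  exact h hA

theorem localAlg_mono (b : ℝ) {O₁ O₂ : Set Cyl} (h : O₁ ⊆ O₂) : localAlg b O₁ ≤ localAlg b O₂ :=
  StarAlgebra.adjoin_mono fun _ ⟨f, n, hf, hX⟩ => ⟨f, n, hf.trans h, hX⟩

/-! ## The pairing -/

variable {μ b : ℝ}

theorem Phi_apply_comm (A B : Obs b) : Phi μ b A B = starRingEnd ℂ (Phi μ b B A) := by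
  change vacuum μ b (star B * A) = starRingEnd ℂ (vacuum μ b (star A * B))
  rw [← vacuum_star, star_mul, star_star]

/-- Vectors of the state space are constant on the fibres of `Φ`. -/
theorem stateSpace_apply_congr {A A' : Obs b} (h : vec μ b A = vec μ b A')
    (z : stateSpace μ b) : z.1 A = z.1 A' := by
  have hPhi : Phi μ b A = Phi μ b A' := congrArg Subtype.val h
  -- Equality of two coordinates is a closed condition, so it suffices to check it on `Φ(𝒜)`, where
  -- hermiticity swaps index and vector.
  have hcl : IsClosed {z : Obs b → ℂ | z A = z A'} :=
    isClosed_eq (continuous_apply A) (continuous_apply A')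
  refine closure_minimal ?_ hcl z.2
  rintro _ ⟨C, rfl⟩
  change Phi μ b C A = Phi μ b C A'
  rw [Phi_apply_comm, hPhi, ← Phi_apply_comm]

/-- Frees the pairing from the preimage chosen in its definition. -/
theorem pairing_of_eq_vec {x : stateSpace μ b} (hx : x ∈ core μ b) {A : Obs b}
    (h : x = vec μ b A) (z : stateSpace μ b) : pairing ⟨x, hx⟩ z = z.1 A :=
  stateSpace_apply_congr ((Classical.choose_spec (LinearMap.mem_range.mp hx)).trans h) z

/-- The adjoint for the pairing is unique. -/
theorem IsAdjointPair.unique {T S S' : stateSpace μ b →L[ℂ] stateSpace μ b}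
    (h : IsAdjointPair T S) (h' : IsAdjointPair T S') : S = S' := by
  obtain ⟨hT, _, h⟩ := h
  obtain ⟨_, _, h'⟩ := h'
  refine ContinuousLinearMap.ext fun z => Subtype.ext (funext fun A => ?_)
  have hA : vec μ b A ∈ core μ b := ⟨A, rfl⟩
  have h1 := (h ⟨vec μ b A, hA⟩ z).1
  have h2 := (h' ⟨vec μ b A, hA⟩ z).1
  rw [pairing_of_eq_vec hA rfl] at h1 h2
  exact h1.symm.trans h2

theorem EndDagger.isAdjointPair_dagger (T : EndDagger μ b) : IsAdjointPair T.op T.dagger :=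
  Classical.choose_spec T.adjointable

theorem rep_vec (C A : Obs b) : rep C (vec μ b A) = vec μ b (C * A) := by
  refine Subtype.ext (funext fun B => ?_)
  change vacuum μ b (star (star C * B) * A) = vacuum μ b (star B * (C * A))
  rw [star_mul, star_star, mul_assoc]

theorem rep_apply (C : Obs b) (z : stateSpace μ b) (A : Obs b) :
    (rep C z).1 A = z.1 (star C * A) := rfl

theorem isAdjointPair_rep (C : Obs b) :
    IsAdjointPair (rep C : stateSpace μ b →L[ℂ] stateSpace μ b) (rep (star C)) := by
  have hmem : ∀ D : Obs b, ∀ u ∈ core μ b, rep D u ∈ core μ b := by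
    rintro D _ ⟨A, rfl⟩
    exact ⟨D * A, (rep_vec D A).symm⟩
  refine ⟨hmem C, hmem (star C), ?_⟩
  rintro ⟨_, A, rfl⟩ z
  have hA : vec μ b A ∈ core μ b := ⟨A, rfl⟩
  rw [pairing_of_eq_vec _ (rep_vec C A), pairing_of_eq_vec _ (rep_vec (star C) A),
    pairing_of_eq_vec hA rfl, pairing_of_eq_vec hA rfl, rep_apply, rep_apply, star_star]
  exact ⟨rfl, rfl⟩

/-! ## The unitary translations -/

/-- The shift `z ↦ (z_{η_{-a,-θ} A})_A` as a continuous linear map. -/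
def cylShiftCLM {b : ℝ} (a : ℝ) (θ : Circ) : (Obs b → ℂ) →L[ℂ] (Obs b → ℂ) :=
  ContinuousLinearMap.pi fun A => ContinuousLinearMap.proj (eta (-a) (-θ) A)

theorem cylShiftCLM_Phi (a : ℝ) (θ : Circ) (A : Obs b) :
    cylShiftCLM a θ (Phi μ b A) = Phi μ b (eta a θ A) := by
  funext B
  change vacuum μ b (star (eta (-a) (-θ) B) * A) = vacuum μ b (star B * eta a θ A)
  -- Translating the whole argument of the vacuum functional by `(a, θ)` cancels the shift on `B`
  -- and moves it to `A`.
  rw [← vacuum_eta μ b a θ, map_mul, eta_star, eta_eta_neg]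

theorem cylShift_mem (a : ℝ) (θ : Circ) (z : stateSpace μ b) :
    cylShiftCLM a θ z.1 ∈ stateSpace μ b := by
  refine map_mem_closure (cylShiftCLM a θ).continuous z.2 ?_
  rintro _ ⟨A, rfl⟩
  exact ⟨eta a θ A, (cylShiftCLM_Phi a θ A).symm⟩

/-- The translation operator on the state space. -/
def cylOp (μ b a : ℝ) (θ : Circ) : stateSpace μ b →L[ℂ] stateSpace μ b :=
  ((cylShiftCLM a θ).comp (stateSpace μ b).subtypeL).codRestrict (stateSpace μ b)
    (cylShift_mem a θ)

theorem cylOp_apply (a : ℝ) (θ : Circ) (z : stateSpace μ b) (A : Obs b) :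
    (cylOp μ b a θ z).1 A = z.1 (eta (-a) (-θ) A) := rfl

theorem cylOp_zero (z : stateSpace μ b) : cylOp μ b 0 0 z = z := by
  refine Subtype.ext (funext fun A => ?_)
  rw [cylOp_apply, neg_zero, neg_zero, eta_zero]

theorem cylOp_add (a a' : ℝ) (θ θ' : Circ) (z : stateSpace μ b) :
    cylOp μ b (a + a') (θ + θ') z = cylOp μ b a θ (cylOp μ b a' θ' z) := by
  refine Subtype.ext (funext fun A => ?_)
  -- Shifts of coordinates compose in the opposite order, hence the reversed form of the negated
  -- sums.
  rw [cylOp_apply, cylOp_apply, cylOp_apply, ← eta_add, neg_add_rev, neg_add_rev]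

/-- The translation operator as a linear homeomorphism `U_cyl(a,θ)`. -/
def cylEquiv (μ b a : ℝ) (θ : Circ) : stateSpace μ b ≃L[ℂ] stateSpace μ b :=
  ContinuousLinearEquiv.equivOfInverse (cylOp μ b a θ) (cylOp μ b (-a) (-θ))
    (fun z => by rw [← cylOp_add, neg_add_cancel, neg_add_cancel, cylOp_zero])
    (fun z => by rw [← cylOp_add, add_neg_cancel, add_neg_cancel, cylOp_zero])

theorem cylEquiv_apply (a : ℝ) (θ : Circ) (z : stateSpace μ b) :
    cylEquiv μ b a θ z = cylOp μ b a θ z := rfl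

theorem cylOp_vec (a : ℝ) (θ : Circ) (A : Obs b) :
    cylOp μ b a θ (vec μ b A) = vec μ b (eta a θ A) :=
  Subtype.ext (cylShiftCLM_Phi a θ A)

theorem cylOp_mem_core (a : ℝ) (θ : Circ) {u : stateSpace μ b} (hu : u ∈ core μ b) :
    cylOp μ b a θ u ∈ core μ b := by
  obtain ⟨A, rfl⟩ := hu
  exact ⟨eta a θ A, (cylOp_vec a θ A).symm⟩

theorem pairing_cylOp (a : ℝ) (θ : Circ) (u : core μ b) (z : stateSpace μ b) :
    pairing ⟨cylOp μ b a θ u, cylOp_mem_core a θ u.2⟩ z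
      = pairing u (cylOp μ b (-a) (-θ) z) := by
  obtain ⟨_, A, rfl⟩ := u
  have hA : vec μ b A ∈ core μ b := ⟨A, rfl⟩
  rw [pairing_of_eq_vec _ (cylOp_vec a θ A), pairing_of_eq_vec hA rfl, cylOp_apply, neg_neg,
    neg_neg]

theorem pairing_cylOp_cylOp (a : ℝ) (θ : Circ) (u : core μ b) (z : stateSpace μ b) :
    pairing ⟨cylOp μ b a θ u, cylOp_mem_core a θ u.2⟩ (cylOp μ b a θ z) = pairing u z := by
  rw [pairing_cylOp, ← cylOp_add, neg_add_cancel, neg_add_cancel, cylOp_zero]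

/-- Conjugation of an operator by `U_cyl(a,θ)`. -/
def cylConj (a : ℝ) (θ : Circ) (T : stateSpace μ b →L[ℂ] stateSpace μ b) :
    stateSpace μ b →L[ℂ] stateSpace μ b :=
  (cylEquiv μ b a θ : stateSpace μ b →L[ℂ] stateSpace μ b) ∘L T ∘L
    ((cylEquiv μ b a θ).symm : stateSpace μ b →L[ℂ] stateSpace μ b)

theorem cylConj_apply (a : ℝ) (θ : Circ) (T : stateSpace μ b →L[ℂ] stateSpace μ b)
    (z : stateSpace μ b) :
    cylConj a θ T z = cylOp μ b a θ (T (cylOp μ b (-a) (-θ) z)) := rfl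

theorem cylConj_rep (a : ℝ) (θ : Circ) (C : Obs b) :
    cylConj a θ (rep C : stateSpace μ b →L[ℂ] stateSpace μ b) = rep (eta a θ C) := by
  refine ContinuousLinearMap.ext fun z => Subtype.ext (funext fun A => ?_)
  rw [cylConj_apply, cylOp_apply, rep_apply, rep_apply, cylOp_apply, neg_neg, neg_neg, map_mul,
    eta_eta_neg, eta_star]

theorem cylConj_cylConj_neg (a : ℝ) (θ : Circ) (T : stateSpace μ b →L[ℂ] stateSpace μ b) :
    cylConj a θ (cylConj (-a) (-θ) T) = T := by
  refine ContinuousLinearMap.ext fun z => ?_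
  rw [cylConj_apply, cylConj_apply, ← cylOp_add, ← cylOp_add]
  simp only [neg_neg, add_neg_cancel, cylOp_zero]

theorem continuous_cylConj (a : ℝ) (θ : Circ) :
    Continuous (cylConj a θ : (stateSpace μ b →L[ℂ] stateSpace μ b) → _) :=
  (ContinuousLinearMap.postcomp (stateSpace μ b)
      (cylEquiv μ b a θ : stateSpace μ b →L[ℂ] stateSpace μ b)).continuous.comp
    (ContinuousLinearMap.precomp (stateSpace μ b)
      ((cylEquiv μ b a θ).symm : stateSpace μ b →L[ℂ] stateSpace μ b)).continuous

theorem IsAdjointPair.cylConj (a : ℝ) (θ : Circ) {T S : stateSpace μ b →L[ℂ] stateSpace μ b}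
    (h : IsAdjointPair T S) : IsAdjointPair (cylConj a θ T) (cylConj a θ S) := by
  obtain ⟨hT, hS, h⟩ := h
  refine ⟨fun u hu => cylOp_mem_core a θ (hT _ (cylOp_mem_core (-a) (-θ) hu)),
    fun u hu => cylOp_mem_core a θ (hS _ (cylOp_mem_core (-a) (-θ) hu)), fun u z => ?_⟩
  have hu := cylOp_mem_core (-a) (-θ) u.2
  have hshift : ∀ y : stateSpace μ b, pairing ⟨cylOp μ b (-a) (-θ) u, hu⟩ y
      = pairing u (cylOp μ b a θ y) := fun y => by
    rw [pairing_cylOp, neg_neg, neg_neg]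
  obtain ⟨h1, h2⟩ := h ⟨_, hu⟩ (cylOp μ b (-a) (-θ) z)
  constructor
  · exact (pairing_cylOp a θ ⟨_, hT _ hu⟩ z).trans (h1.trans (hshift _))
  · exact (pairing_cylOp a θ ⟨_, hS _ hu⟩ z).trans (h2.trans (hshift _))

/-- Conjugation by `U_cyl(a,θ)` on `End_†(ℋ)`. -/
def EndDagger.cylConj (a : ℝ) (θ : Circ) (T : EndDagger μ b) : EndDagger μ b :=
  ⟨TimelikeLiouville.cylConj a θ T.op, _, T.isAdjointPair_dagger.cylConj a θ⟩

/-- The adjoint is a chosen one; uniqueness identifies it with the conjugated adjoint. -/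
theorem EndDagger.dagger_cylConj (a : ℝ) (θ : Circ) (T : EndDagger μ b) :
    (T.cylConj a θ).dagger = TimelikeLiouville.cylConj a θ T.dagger :=
  (T.cylConj a θ).isAdjointPair_dagger.unique (T.isAdjointPair_dagger.cylConj a θ)

theorem EndDagger.continuous_cylConj (a : ℝ) (θ : Circ) :
    Continuous (EndDagger.cylConj a θ : EndDagger μ b → EndDagger μ b) := by
  refine continuous_induced_rng.mpr ?_
  -- In the coordinates `(T, T†)` that induce the topology, conjugation acts separately on each
  -- factor.
  have hcomp : (fun T : EndDagger μ b => (T.op, T.dagger)) ∘ EndDagger.cylConj a θ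
      = Prod.map (TimelikeLiouville.cylConj a θ) (TimelikeLiouville.cylConj a θ)
        ∘ fun T : EndDagger μ b => (T.op, T.dagger) :=
    funext fun T => Prod.ext rfl (T.dagger_cylConj a θ)
  rw [hcomp]
  exact ((TimelikeLiouville.continuous_cylConj a θ).prodMap
    (TimelikeLiouville.continuous_cylConj a θ)).comp continuous_induced_dom

/-! ## Covariance of the represented local net -/

theorem localNet_mono (μ b : ℝ) {O₁ O₂ : Set Cyl} (h : O₁ ⊆ O₂) :
    localNet μ b O₁ ⊆ localNet μ b O₂ :=
  Set.image_mono (closure_mono fun _ ⟨C, hC, hT⟩ => ⟨C, localAlg_mono b h hC, hT⟩)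

theorem cylConj_mem_localNet (a : ℝ) (θ : Circ) {O : Set Cyl}
    {T : stateSpace μ b →L[ℂ] stateSpace μ b} (hT : T ∈ localNet μ b O) :
    cylConj a θ T ∈ localNet μ b (cylTranslate a θ '' O) := by
  obtain ⟨T, hT, rfl⟩ := hT
  refine ⟨T.cylConj a θ, map_mem_closure (EndDagger.continuous_cylConj a θ) hT ?_, rfl⟩
  rintro S ⟨C, hC, hS⟩
  refine ⟨eta a θ C, eta_mem_localAlg a θ hC, ?_⟩
  rw [← cylConj_rep, ← hS]
  rfl

theorem cylTranslate_neg_image (a : ℝ) (θ : Circ) (O : Set Cyl) :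
    cylTranslate (-a) (-θ) '' (cylTranslate a θ '' O) = O := by
  rw [Set.image_image]
  simp [cylTranslate]

theorem cylConj_image_localNet (a : ℝ) (θ : Circ) (O : Set Cyl) :
    cylConj a θ '' localNet μ b O = localNet μ b (cylTranslate a θ '' O) := by
  refine Set.Subset.antisymm ?_ fun T hT => ⟨cylConj (-a) (-θ) T, ?_, cylConj_cylConj_neg a θ T⟩
  · rintro _ ⟨T, hT, rfl⟩
    exact cylConj_mem_localNet a θ hT
  -- The reverse inclusion is the forward one for the inverse translation.
  · simpa only [cylTranslate_neg_image] using cylConj_mem_localNet (-a) (-θ) hT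

end

end TimelikeLiouville

theorem theorem2p13 (μ b : ℝ) (hμ : 0 < μ) (hb : 0 < b) (hb' : b < 1 / Real.sqrt 2) :
    (∀ (A : Obs b) (z : stateSpace μ b),
      pairing ⟨vec μ b A, LinearMap.mem_range_self (vec μ b) A⟩ z = z.1 A) ∧
    (∀ C : Obs b, ∃ T : EndDagger μ b, T.op = rep C ∧ T.dagger = rep (star C)) ∧
    ∃ U : ℝ → Circ → (stateSpace μ b ≃L[ℂ] stateSpace μ b),
      (∀ a θ (z : stateSpace μ b), (U a θ z).1 = cylShift a θ z.1) ∧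
      (∀ z, U 0 0 z = z) ∧
      (∀ a θ a' θ' z, U (a + a') (θ + θ') z = U a θ (U a' θ' z)) ∧
      (∀ a θ A, U a θ (vec μ b A) = vec μ b (eta a θ A)) ∧
      (∃ hU : ∀ a θ, ∀ u ∈ core μ b, U a θ u ∈ core μ b,
        (∀ a θ (u : core μ b) (z : stateSpace μ b),
          pairing ⟨U a θ u, hU a θ u u.2⟩ z = pairing u (U (-a) (-θ) z)) ∧
        (∀ a θ (u v : core μ b), pairing ⟨U a θ u, hU a θ u u.2⟩ (U a θ v) = pairing u v)) ∧
      (∀ a θ, U a θ (Omega μ b) = Omega μ b) ∧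
      (∀ a θ (C : Obs b),
        (U a θ : stateSpace μ b →L[ℂ] stateSpace μ b) ∘L rep C ∘L
          ((U a θ).symm : stateSpace μ b →L[ℂ] stateSpace μ b) = rep (eta a θ C)) ∧
      (∀ O₁ O₂ : Set Cyl, IsOpen O₁ → IsOpen O₂ → O₁ ⊆ O₂ →
        localNet μ b O₁ ⊆ localNet μ b O₂) ∧
      (∀ a θ (O : Set Cyl), IsOpen O →
        (fun T : stateSpace μ b →L[ℂ] stateSpace μ b =>
          (U a θ : stateSpace μ b →L[ℂ] stateSpace μ b) ∘L T ∘L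
            ((U a θ).symm : stateSpace μ b →L[ℂ] stateSpace μ b)) '' localNet μ b O
          = localNet μ b (cylTranslate a θ '' O)) ∧
      (∀ t A, U t 0 (vec μ b A) = vec μ b (tau (-t) A)) ∧
      (∀ s t z, U (s + t) 0 z = U s 0 (U t 0 z)) := by
  refine ⟨fun A z => pairing_of_eq_vec _ rfl z,
    fun C => ⟨⟨rep C, _, isAdjointPair_rep C⟩, rfl,
      (EndDagger.isAdjointPair_dagger _).unique (isAdjointPair_rep C)⟩,
    cylEquiv μ b, fun _ _ _ => rfl, cylOp_zero, fun a θ a' θ' => cylOp_add a a' θ θ', cylOp_vec,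
    ⟨fun a θ _ => cylOp_mem_core a θ, pairing_cylOp, fun a θ u v => pairing_cylOp_cylOp a θ u v⟩,
    fun a θ => ?_, cylConj_rep, fun _ _ _ _ => localNet_mono μ b,
    fun a θ O _ => cylConj_image_localNet a θ O, fun t A => ?_, fun s t z => ?_⟩
  · rw [Omega, cylEquiv_apply, cylOp_vec, map_one]
  · rw [tau, neg_neg, cylEquiv_apply, cylOp_vec]
  · rw [cylEquiv_apply, cylEquiv_apply, cylEquiv_apply, ← cylOp_add, add_zero]
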